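/- **Setting.** Let $V$ be a linearly ordered set of Boolean variables. A literal is $x$ or $\overline{x}=1-x$. A pseudo-Boolean (PB) constraint is $\sum_j c_j\ell_j \bowtie b$ with $c_j,b\in\mathbb Z$, literals $\ell_j$ (repetitions allowed) and ${\bowtie}\in\{\ge,>,\le,<,=\}$; a PBO instance $(F,O)$ consists of a finite list $F$ of PB constraints and an optional objective $O=\sum_j c_j\ell_j+k$ with $c_j,k\in\mathbb Z$ (an absent objective counts as $0$). Every constraint is equivalent to one normalized constraint $\sum_j a_j\ell_j\ge A$ (two for an equality) with $a_j>0$, $A\ge 0$ and distinct variables in increasing order; every objective has a canonical form $\sum_i c_ix_i+k$ with increasing variables and $c_i\neq0$. Below, constraints and objectives are kept in these forms; $\neg C$ is the constraint $\sum_j a_j\ell_j\le A-1$ and $C|_\omega$ is the (renormalized) result of applying to $C$ a finite substitution $\omega$ of variables by truth values or literals. **Checker.** The checker maintains numbered core constraints $\mathcal C$ (initially the normalized constraints of $F$), numbered derived constraints $\mathcal D$ (initially empty) and a current objective (initially $O$). A proof is a list of the following steps. 1. *Cutting planes*: add to $\mathcal D$ a constraint obtained from $\mathcal C\cup\mathcal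 D$ and literal axioms $\ell\ge0$ by addition, multiplication by a positive integer, division by a positive integer $d$ with rounding up ($\sum_j\lceil a_j/d\rceil\ell_j\ge\lceil A/d\rceil$), and saturation ($\sum_j\min\{a_j,A\}\ell_j\ge A$). 2. *RUP*: add $C$ to $\mathcal D$ if repeated unit propagation on $\mathcal C\cup\mathcal D\cup\{\neg C\}$, from the empty assignment, reaches a contradiction. 3. *Redundance-based strengthening*: add $C$ to $\mathcal D$, given a substitution $\omega$ for which all goals of $\mathcal C\cup\mathcal D\cup\{\neg C\}\vdash(\mathcal C\cup\mathcal D\cup\{C\})|_\omega\cup\{O\ge O|_\omega\}$ are derived, $O$ being the current objective. 4. Move a constraint from $\mathcal D$ to $\mathcal C$, or delete a constraint from $\mathcal D$. 5. *Checked deletion*: delete $C$ from $\mathcal C$, given a substitution $\omega$ for which all goals of $(\mathcal C\setminus\{C\})\cup\{\neg C\}\vdash((\mathcal C\setminus\{C\})\cup\{C\})|_\omega\cup\{O\ge O|_\omega\}$ are derived. 6. *Objective update*: replace the current objective $O$ by $O_1$ if $O\ge O_1$ and $O_1\ge O$ are derived from $\mathcal C$. In 3, 5 and 6 a goal $G$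 is derived from a set of constraints $\mathcal E$ if a supplied subproof, consisting of steps of kinds 1 and 2 from $\mathcal E\cup\{\neg G\}$, yields a constraint whose coefficients sum to less than its right-hand side, or, when no subproof is supplied, if $G\in\mathcal E$ or $G$ is RUP with respect to $\mathcal E$. If every step is accepted and the proof ends with an output section claiming equioptimality with an output instance $(F',O')$, the checker declares equioptimality exactly when the final $\mathcal C$ and the set of normalized constraints of $F'$ contain each other and the current objective has the same canonical form as $O'$. **Theorem (soundness of CakePB reformulation checking).** If this checker (CakePB), run on an input instance $(\mathit{fml},\mathit{obj})$, a proof, and an output instance $(\mathit{fml}',\mathit{obj}')$, accepts the proof and declares equioptimality, then the two instances are equioptimal: for every $v\in\mathbb Z$, $$\bigl(\exists w:V\to\{0,1\}.\ w\models \mathit{fml}\ \wedge\ \mathit{obj}(w)\le v\bigr)\iff\bigl(\exists w':V\to\{0,1\}.\ w'\models \mathit{fml}'\ \wedge\ \mathit{obj}'(w')\le v\bigr).$$ -/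

import Mathlib

namespace CakePB

/-! ## Pseudo-Boolean constraints, objectives and their semantics -/

/-- A literal: a Boolean variable or its negation. -/
inductive Lit (V : Type*) where
  | pos (v : V)
  | neg (v : V)
  deriving DecidableEq

/-- The complementary literal. -/
def Lit.negate {V : Type*} : Lit V → Lit V
  | .pos v => .neg v
  | .neg v => .pos v

/-- The value in `{0, 1}` of a literal under a total assignment. -/
def Lit.eval {V : Type*} (w : V → Bool) : Lit V → ℤ
  | .pos v => if w v then 1 else 0
  | .neg v => if w v then 0 else 1

/-- A formal sum `∑ cⱼ ℓⱼ`; integers of any sign, literals may be repeated or opposite. -/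
abbrev LinSum (V : Type*) := List (ℤ × Lit V)

/-- The value of a formal sum under a total assignment. -/
def LinSum.eval {V : Type*} (w : V → Bool) (t : LinSum V) : ℤ :=
  (t.map fun p => p.1 * p.2.eval w).sum

/-- The comparison operators allowed in input and output constraints. -/
inductive Rel where
  | ge | gt | le | lt | eq

/-- Meaning of a comparison operator. -/
def Rel.holds : Rel → ℤ → ℤ → Prop
  | .ge, a, b => a ≥ b
  | .gt, a, b => a > b
  | .le, a, b => a ≤ b
  | .lt, a, b => a < b
  | .eq, a, b => a = b

/-- A pseudo-Boolean constraint `∑ cⱼ ℓⱼ ⋈ b`, as written by a user (not normalized). -/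
structure PBConstr (V : Type*) where
  rel : Rel
  lhs : LinSum V
  rhs : ℤ

/-- A pseudo-Boolean objective `∑ cⱼ ℓⱼ + const`, to be minimized. -/
structure Objective (V : Type*) where
  lhs : LinSum V
  const : ℤ

/-- The total assignment `w` satisfies every constraint of `fml`. -/
def Satisfies {V : Type*} (w : V → Bool) (fml : Set (PBConstr V)) : Prop :=
  ∀ c ∈ fml, c.rel.holds (c.lhs.eval w) c.rhs

/-- Value of an optional objective (an absent objective is constantly `0`). -/
def evalObj {V : Type*} (obj : Option (Objective V)) (w : V → Bool) : ℤ :=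
  match obj with
  | none => 0
  | some o => o.lhs.eval w + o.const

/-- Equioptimality of `(fml, obj)` and `(fml', obj')`: for every value `v`, one has a satisfying
assignment with objective value at most `v` iff the other has. -/
def SemOutputEquioptimal {V : Type*} (fml : Set (PBConstr V)) (obj : Option (Objective V))
    (fml' : Set (PBConstr V)) (obj' : Option (Objective V)) : Prop :=
  ∀ v : ℤ, (∃ w : V → Bool, Satisfies w fml ∧ evalObj obj w ≤ v) ↔
    (∃ w' : V → Bool, Satisfies w' fml' ∧ evalObj obj' w' ≤ v)

/-! ## Normal forms -/

/-- A linear form `∑ cᵢ xᵢ + const` over variables.  The canonical representation, produced by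
`normLin`, has strictly increasing variables and nonzero coefficients. -/
structure LinForm (V : Type*) where
  terms : List (ℤ × V)
  const : ℤ
  deriving DecidableEq

/-- A constraint `∑ aⱼ ℓⱼ ≥ degree` in normalized form: natural coefficients and degree.  The
canonical representation has nonzero coefficients and literals over strictly increasing
variables. -/
structure Constr (V : Type*) where
  terms : List (ℕ × Lit V)
  degree : ℕ
  deriving DecidableEq

/-- Add `c · x_v` to a sum over sorted variables, merging with an existing term for `v`. -/
def insertTerm {V : Type*} [LinearOrder V] (c : ℤ) (v : V) : List (ℤ × V) → List (ℤ × V)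
  | [] => if c = 0 then [] else [(c, v)]
  | (d, u) :: r =>
    if v < u then (if c = 0 then (d, u) :: r else (c, v) :: (d, u) :: r)
    else if v = u then (if c + d = 0 then r else (c + d, u) :: r)
    else (d, u) :: insertTerm c v r

/-- Add `c · ℓ` to a linear form, using `¬x = 1 - x`. -/
def LinForm.insertLit {V : Type*} [LinearOrder V] (f : LinForm V) (c : ℤ) : Lit V → LinForm V
  | .pos v => ⟨insertTerm c v f.terms, f.const⟩
  | .neg v => ⟨insertTerm (-c) v f.terms, f.const + c⟩

/-- The canonical linear form of `t + k`. -/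
def normLin {V : Type*} [LinearOrder V] : LinSum V → ℤ → LinForm V
  | [], k => ⟨[], k⟩
  | (c, l) :: r, k => (normLin r k).insertLit c l

/-- A linear form read as a formal sum of positive literals (without its constant). -/
def LinForm.toSum {V : Type*} (f : LinForm V) : LinSum V :=
  f.terms.map fun p => (p.1, Lit.pos p.2)

/-- The normalized form of the constraint `f ≥ 0`: a negative term `c x` is rewritten as
`|c| ¬x - |c|`, and a negative degree is replaced by `0`. -/
def LinForm.nonneg {V : Type*} (f : LinForm V) : Constr V where
  terms := f.terms.map fun p => (p.1.natAbs, if 0 < p.1 then Lit.pos p.2 else Lit.neg p.2)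
  degree := ((f.terms.map fun p => max (-p.1) 0).sum - f.const).toNat

/-- The normalized form of `t ≥ b`. -/
def normGe {V : Type*} [LinearOrder V] (t : LinSum V) (b : ℤ) : Constr V :=
  (normLin t (-b)).nonneg

/-- The formal sum `-t`. -/
def LinSum.negate {V : Type*} (t : LinSum V) : LinSum V :=
  t.map fun p => (-p.1, p.2)

/-- The normalized form of `f ≥ g`. -/
def LinForm.geConstr {V : Type*} [LinearOrder V] (f g : LinForm V) : Constr V :=
  normGe (f.toSum ++ g.toSum.negate) (g.const - f.const)

/-- The normalized constraints (two for an equality) equivalent to a given constraint. -/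
def PBConstr.normalize {V : Type*} [LinearOrder V] (c : PBConstr V) : List (Constr V) :=
  match c.rel with
  | .ge => [normGe c.lhs c.rhs]
  | .gt => [normGe c.lhs (c.rhs + 1)]
  | .le => [normGe c.lhs.negate (-c.rhs)]
  | .lt => [normGe c.lhs.negate (-c.rhs + 1)]
  | .eq => [normGe c.lhs c.rhs, normGe c.lhs.negate (-c.rhs)]

/-- The normalized constraints of a formula. -/
def normFormula {V : Type*} [LinearOrder V] (fml : List (PBConstr V)) : List (Constr V) :=
  fml.flatMap PBConstr.normalize

/-- The canonical linear form of an objective (an absent objective is the zero form). -/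
def normObj {V : Type*} [LinearOrder V] : Option (Objective V) → LinForm V
  | none => ⟨[], 0⟩
  | some o => normLin o.lhs o.const

/-! ## Operations on normalized constraints -/

/-- The left-hand side of a normalized constraint as a formal sum. -/
def Constr.toSum {V : Type*} (C : Constr V) : LinSum V :=
  C.terms.map fun p => ((p.1 : ℤ), p.2)

/-- The sum of all coefficients. -/
def Constr.total {V : Type*} (C : Constr V) : ℕ := (C.terms.map fun p => p.1).sum

/-- No assignment satisfies the constraint: the coefficients do not add up to the degree. -/
def Constr.contradictory {V : Type*} (C : Constr V) : Bool := decide (C.total < C.degree)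

/-- Negation: `∑ aⱼ ℓⱼ ≤ degree - 1`, written as `∑ aⱼ ¬ℓⱼ ≥ ∑ aⱼ + 1 - degree` (the degree is
`0` if the right-hand side is negative). -/
def Constr.negate {V : Type*} (C : Constr V) : Constr V where
  terms := C.terms.map fun p => (p.1, p.2.negate)
  degree := C.total + 1 - C.degree

/-- Addition of two constraints, with cancellation of opposite literals. -/
def Constr.plus {V : Type*} [LinearOrder V] (C D : Constr V) : Constr V :=
  normGe (C.toSum ++ D.toSum) ((C.degree : ℤ) + D.degree)

/-- Multiplication by a natural number. -/
def Constr.times {V : Type*} (C : Constr V) (k : ℕ) : Constr V where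
  terms := C.terms.map fun p => (k * p.1, p.2)
  degree := k * C.degree

/-- Division by a positive integer `d`, rounding coefficients and degree up. -/
def Constr.divide {V : Type*} (C : Constr V) (d : ℕ) : Constr V where
  terms := C.terms.map fun p => ((p.1 + d - 1) / d, p.2)
  degree := (C.degree + d - 1) / d

/-- Saturation: coefficients are capped at the degree (terms that become `0` are dropped). -/
def Constr.saturate {V : Type*} (C : Constr V) : Constr V where
  terms := (C.terms.map fun p => (min p.1 C.degree, p.2)).filter fun p => p.1 ≠ 0
  degree := C.degree

/-- A finite substitution; each listed variable is mapped to a truth value or to a literal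
(the first entry counts), all other variables are left alone. -/
abbrev Subst (V : Type*) := List (V × (Bool ⊕ Lit V))

/-- Image of a literal under a substitution. -/
def Subst.onLit {V : Type*} [DecidableEq V] (ω : Subst V) : Lit V → Bool ⊕ Lit V
  | .pos v =>
    match ω.find? fun p => decide (p.1 = v) with
    | none => .inr (.pos v)
    | some p => p.2
  | .neg v =>
    match ω.find? fun p => decide (p.1 = v) with
    | none => .inr (.neg v)
    | some (_, .inl b) => .inl (!b)
    | some (_, .inr l) => .inr l.negate

/-- The canonical linear form of `(t + k)|ω`. -/
def Subst.onLin {V : Type*} [LinearOrder V] (ω : Subst V) : LinSum V → ℤ → LinForm V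
  | [], k => ⟨[], k⟩
  | (c, l) :: r, k =>
    match ω.onLit l with
    | .inl true => ω.onLin r (k + c)
    | .inl false => ω.onLin r k
    | .inr m => (ω.onLin r k).insertLit c m

/-- The restricted constraint `C|ω`. -/
def Constr.subst {V : Type*} [LinearOrder V] (ω : Subst V) (C : Constr V) : Constr V :=
  (ω.onLin C.toSum (-(C.degree : ℤ))).nonneg

/-- The restricted objective `O|ω`. -/
def LinForm.subst {V : Type*} [LinearOrder V] (ω : Subst V) (f : LinForm V) : LinForm V :=
  ω.onLin f.toSum f.const

/-! ## Reverse unit propagation -/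

/-- `∑ aⱼ - degree`, the sum ranging over the literals not falsified by the partial assignment
`ρ`, which is given as the list of its true literals. -/
def slack {V : Type*} [DecidableEq V] (ρ : List (Lit V)) (C : Constr V) : ℤ :=
  (((C.terms.filter fun p => decide (p.2.negate ∉ ρ)).map fun p => p.1).sum : ℕ) - (C.degree : ℤ)

/-- Unit propagation of one constraint under `ρ`.  The result is `none` if `C|ρ` is
unsatisfiable; otherwise `ρ` is extended by all unassigned literals `ℓ` without which `C|ρ` cannot
be satisfied, that is, whose coefficient exceeds the slack. -/
def propagateConstr {V : Type*} [DecidableEq V] (ρ : List (Lit V)) (C : Constr V) :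
    Option (List (Lit V)) :=
  if slack ρ C < 0 then none
  else some (((C.terms.filter fun p =>
    decide (p.2 ∉ ρ ∧ p.2.negate ∉ ρ ∧ slack ρ C < (p.1 : ℤ))).map fun p => p.2) ++ ρ)

/-- At most `n` rounds of unit propagation over all constraints of `db`, starting from `ρ`; the
result tells whether a contradiction was reached. -/
def propagate {V : Type*} [DecidableEq V] (db : List (Constr V)) : ℕ → List (Lit V) → Bool
  | 0, _ => false
  | n + 1, ρ =>
    match db.foldlM propagateConstr ρ with
    | none => true
    | some σ => propagate db n σ

/-- `C` follows from `db` by reverse unit propagation.  A round that is not the last one assigns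
a new variable, so the number of rounds allowed is enough to reach the fixed point. -/
def rup {V : Type*} [DecidableEq V] (db : List (Constr V)) (C : Constr V) : Bool :=
  let all := C.negate :: db
  propagate all ((all.map fun D => D.terms.length).sum + 1) []

/-! ## Derivations -/

/-- Constraints in the database are addressed by numbers. -/
abbrev Database (V : Type*) := List (ℕ × Constr V)

/-- The entry with number `n`. -/
def Database.entry {V : Type*} (db : Database V) (n : ℕ) : Option (ℕ × Constr V) :=
  db.find? fun e => decide (e.1 = n)

/-- The database without its entry with number `n`. -/
def Database.remove {V : Type*} (db : Database V) (n : ℕ) : Database V :=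
  db.eraseP fun e => decide (e.1 = n)

/-- The constraints of a database. -/
def Database.constrs {V : Type*} (db : Database V) : List (Constr V) := db.map fun e => e.2

/-- Cutting planes expressions. -/
inductive CuttingPlanes (V : Type*) where
  | ref (n : ℕ)
  | literalAxiom (l : Lit V)
  | plus (p q : CuttingPlanes V)
  | times (p : CuttingPlanes V) (k : ℕ)
  | divide (p : CuttingPlanes V) (d : ℕ)
  | saturate (p : CuttingPlanes V)

/-- The constraint derived by a cutting planes expression (`none` if it is ill-formed). -/
def CuttingPlanes.run {V : Type*} [LinearOrder V] (db : Database V) :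
    CuttingPlanes V → Option (Constr V)
  | .ref n => (db.entry n).map fun e => e.2
  | .literalAxiom l => some ⟨[(1, l)], 0⟩
  | .plus p q => do return (← p.run db).plus (← q.run db)
  | .times p k => if 0 < k then (p.run db).map fun C => C.times k else none
  | .divide p d => if 0 < d then (p.run db).map fun C => C.divide d else none
  | .saturate p => (p.run db).map Constr.saturate

/-- Steps deriving an implied constraint: a cutting planes expression, or reverse unit propagation
of the constraint `t ≥ b`. -/
inductive ImpStep (V : Type*) where
  | cp (p : CuttingPlanes V)
  | rup (t : LinSum V) (b : ℤ)

/-- The constraint derived by a step (`none` if the step is rejected). -/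
def ImpStep.run {V : Type*} [LinearOrder V] (db : Database V) : ImpStep V → Option (Constr V)
  | .cp p => p.run db
  | .rup t b => if CakePB.rup db.constrs (normGe t b) then some (normGe t b) else none

/-- Run a list of steps; the derived constraints are numbered `next, next + 1, …`. -/
def runImpSteps {V : Type*} [LinearOrder V] :
    Database V → ℕ → List (ImpStep V) → Option (Database V)
  | db, _, [] => some db
  | db, next, s :: r =>
    match s.run db with
    | none => none
    | some C => runImpSteps ((next, C) :: db) (next + 1) r

/-- A subproof: steps, and the number of a constraint that is contradictory after them. -/
structure Subproof (V : Type*) where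
  steps : List (ImpStep V)
  contra : ℕ

/-- Check that the goal `G` is derived from `db`.  An explicit subproof may use the negation of
`G` (under number `next`) and has to reach a contradiction; without a subproof, `G` must be in the
database or follow by reverse unit propagation. -/
def checkGoal {V : Type*} [LinearOrder V] (db : Database V) (next : ℕ)
    (sub : Option (Subproof V)) (G : Constr V) : Bool :=
  match sub with
  | none => decide (G ∈ db.constrs) || rup db.constrs G
  | some sp =>
    match runImpSteps ((next, G.negate) :: db) (next + 1) sp.steps with
    | none => false
    | some db' =>
      match db'.entry sp.contra with
      | none => false
      | some e => e.2.contradictory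

/-- Labels of the goals of a redundance check: the restriction of a database constraint, the
restriction of the new constraint, and the objective condition. -/
inductive GoalLabel where
  | db (n : ℕ)
  | new
  | obj
  deriving DecidableEq

/-- Subproofs, by label of the goal. -/
abbrev Subproofs (V : Type*) := List (GoalLabel × Subproof V)

/-- The subproof given for a label. -/
def Subproofs.get {V : Type*} (pfs : Subproofs V) (g : GoalLabel) : Option (Subproof V) :=
  (pfs.find? fun p => decide (p.1 = g)).map fun p => p.2

/-- The redundance condition for adding `C` to `db` with witness `ω` under the objective `O`:
`db ∪ {¬C} ⊢ (db ∪ {C})|ω ∪ {O ≥ O|ω}`.  The negation of `C` gets the number `next`. -/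
def checkRedundant {V : Type*} [LinearOrder V] (db : Database V) (next : ℕ) (O : LinForm V)
    (C : Constr V) (ω : Subst V) (pfs : Subproofs V) : Bool :=
  let hyp : Database V := (next, C.negate) :: db
  let check := fun (g : GoalLabel) (G : Constr V) => checkGoal hyp (next + 1) (pfs.get g) G
  (db.all fun e => check (.db e.1) (e.2.subst ω)) &&
    check .new (C.subst ω) && check .obj (O.geConstr (O.subst ω))

/-! ## The proof checker -/

/-- Proof steps. -/
inductive Step (V : Type*) where
  /-- derive an implied constraint -/
  | derive (s : ImpStep V)
  /-- redundance-based strengthening by `t ≥ b` with witness `ω` -/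
  | red (t : LinSum V) (b : ℤ) (ω : Subst V) (pfs : Subproofs V)
  /-- move a derived constraint to the core -/
  | toCore (n : ℕ)
  /-- delete a derived constraint -/
  | deleteDerived (n : ℕ)
  /-- checked deletion of a core constraint -/
  | deleteCore (n : ℕ) (ω : Subst V) (pfs : Subproofs V)
  /-- objective update, with subproofs of `old ≥ new` and `new ≥ old` -/
  | updateObj (o : Objective V) (geNew geOld : Option (Subproof V))

/-- State of the checker: core and derived constraints, next unused number, objective. -/
structure State (V : Type*) where
  core : Database V
  derived : Database V
  next : ℕ
  obj : LinForm V

/-- All constraints of a state. -/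
def State.all {V : Type*} (s : State V) : Database V := s.core ++ s.derived

/-- Put a new constraint into the derived set. -/
def State.addDerived {V : Type*} (s : State V) (C : Constr V) : State V :=
  { s with derived := (s.next, C) :: s.derived, next := s.next + 1 }

/-- Check one step; `none` means that the step is rejected. -/
def State.step {V : Type*} [LinearOrder V] (s : State V) : Step V → Option (State V)
  | .derive i => (i.run s.all).map s.addDerived
  | .red t b ω pfs =>
    if checkRedundant s.all s.next s.obj (normGe t b) ω pfs then
      some (s.addDerived (normGe t b))
    else none
  | .toCore n =>
    match s.derived.entry n with
    | none => none
    | some e => some { s with core := e :: s.core, derived := s.derived.remove n }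
  | .deleteDerived n =>
    match s.derived.entry n with
    | none => none
    | some _ => some { s with derived := s.derived.remove n }
  | .deleteCore n ω pfs =>
    match s.core.entry n with
    | none => none
    | some e =>
      if checkRedundant (s.core.remove n) s.next s.obj e.2 ω pfs then
        some { s with core := s.core.remove n }
      else none
  | .updateObj o geNew geOld =>
    let f := normLin o.lhs o.const
    if checkGoal s.core s.next geNew (s.obj.geConstr f) &&
        checkGoal s.core s.next geOld (f.geConstr s.obj) then
      some { s with obj := f }
    else none

/-- The initial state: the normalized input constraints, numbered from `1`, form the core. -/
def initState {V : Type*} [LinearOrder V] (fml : List (PBConstr V))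
    (obj : Option (Objective V)) : State V where
  core := (normFormula fml).mapIdx fun i C => (i + 1, C)
  derived := []
  next := (normFormula fml).length + 1
  obj := normObj obj

/-- Claims that a proof can make in its output section. -/
inductive OutputClaim where
  | nothing
  | equioptimal
  deriving DecidableEq

/-- A proof: its steps, followed by the claim of its output section. -/
structure PBProof (V : Type*) where
  steps : List (Step V)
  output : OutputClaim

/-- Reformulation check for equioptimality: after normalization, the core constraints and the
output constraints include each other, and the current objective and the output objective are
syntactically equal. -/
def checkEquioptimal {V : Type*} [LinearOrder V] (s : State V) (fml' : List (PBConstr V))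
    (obj' : Option (Objective V)) : Bool :=
  (s.core.constrs.all fun C => decide (C ∈ normFormula fml')) &&
    ((normFormula fml').all fun C => decide (C ∈ s.core.constrs)) &&
    decide (s.obj = normObj obj')

/-- The proof checker, run on an input instance, a proof, and an output instance.  It returns the
claim of the output section as its verdict, or `none` if the proof is rejected. -/
def cakePB {V : Type*} [LinearOrder V] (fml : List (PBConstr V)) (obj : Option (Objective V))
    (pf : PBProof V) (fml' : List (PBConstr V)) (obj' : Option (Objective V)) :
    Option OutputClaim :=
  match pf.steps.foldlM State.step (initState fml obj) with
  | none => none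
  | some s =>
    match pf.output with
    | .nothing => some .nothing
    | .equioptimal => if checkEquioptimal s fml' obj' then some .equioptimal else none

end CakePB

namespace CakePB

variable {V : Type*}

/-! ## Semantics of literals, linear forms and normalized constraints -/

/-! Two properties are followed through a run. `State.Valid` says that any solution of the core can
be repaired to a solution of core and derived constraints together at no greater cost;
`State.Attains` records which bounds `v` the core can reach. `State.step_sound` shows that every
accepted step keeps validity and changes no attained bound. Validity cannot be strengthened to "the
core implies the derived constraints", because strengthening adds constraints that are not implied.

The engine is `checkRedundant_sound`. If `w` violates `C`, then `w` satisfies all the hypotheses of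
the redundance check, so the restricted goals hold at `w`. By the substitution lemmas
`Constr.sat_subst` and `LinForm.eval_subst`, this says that `w` composed with `ω` satisfies the
unrestricted goals, `C` included, at no greater cost. Everything else rests on `checkGoal_sound`:
derived goals are semantic consequences, since cutting planes rules preserve solutions and unit
propagation never loses one.

At both ends of the run, the core has the same members as a normalized formula, and normalization
preserves meaning, so `State.attains_iff` turns attained bounds into the two sides of the claim. -/

/-- Truth of a literal under a total assignment. -/
def Lit.truth (w : V → Bool) : Lit V → Bool
  | .pos v => w v
  | .neg v => !w v

theorem Lit.eval_eq_truth (w : V → Bool) (l : Lit V) :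
    l.eval w = if l.truth w then 1 else 0 := by
  cases l with
  | pos v => rfl
  | neg v => cases h : w v <;> simp [Lit.eval, Lit.truth, h]

@[simp] theorem Lit.truth_negate (w : V → Bool) (l : Lit V) :
    l.negate.truth w = !l.truth w := by
  cases l <;> simp [Lit.negate, Lit.truth]

@[simp] theorem LinSum.eval_nil (w : V → Bool) : LinSum.eval w [] = 0 := rfl

@[simp] theorem LinSum.eval_cons (w : V → Bool) (p : ℤ × Lit V) (t : LinSum V) :
    LinSum.eval w (p :: t) = p.1 * p.2.eval w + LinSum.eval w t := by
  simp [LinSum.eval]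

@[simp] theorem LinSum.eval_append (w : V → Bool) (s t : LinSum V) :
    LinSum.eval w (s ++ t) = LinSum.eval w s + LinSum.eval w t := by
  simp [LinSum.eval]

@[simp] theorem LinSum.eval_negate (w : V → Bool) (t : LinSum V) :
    LinSum.eval w t.negate = -LinSum.eval w t := by
  induction t with
  | nil => rfl
  | cons p t ih =>
    have : LinSum.negate (p :: t) = (-p.1, p.2) :: LinSum.negate t := rfl
    rw [this, LinSum.eval_cons, LinSum.eval_cons, ih]
    ring

/-- The value of a sum over variables. -/
def termsEval (w : V → Bool) (t : List (ℤ × V)) : ℤ :=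
  (t.map fun p => p.1 * if w p.2 then 1 else 0).sum

@[simp] theorem termsEval_nil (w : V → Bool) : termsEval w [] = 0 := rfl

@[simp] theorem termsEval_cons (w : V → Bool) (p : ℤ × V) (t : List (ℤ × V)) :
    termsEval w (p :: t) = p.1 * (if w p.2 then 1 else 0) + termsEval w t := by
  simp [termsEval]

/-- The value of a linear form under a total assignment. -/
def LinForm.eval (w : V → Bool) (f : LinForm V) : ℤ := termsEval w f.terms + f.const

/-- The value of a sum of literals with natural coefficients. -/
def natEval (w : V → Bool) (t : List (ℕ × Lit V)) : ℕ :=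
  (t.map fun p => if p.2.truth w then p.1 else 0).sum

@[simp] theorem natEval_nil (w : V → Bool) : natEval w [] = 0 := rfl

@[simp] theorem natEval_cons (w : V → Bool) (p : ℕ × Lit V) (t : List (ℕ × Lit V)) :
    natEval w (p :: t) = (if p.2.truth w then p.1 else 0) + natEval w t := by
  simp [natEval]

/-- The assignment satisfies the normalized constraint. -/
def Constr.Sat (w : V → Bool) (C : Constr V) : Prop := C.degree ≤ natEval w C.terms

theorem Constr.eval_toSum (w : V → Bool) (C : Constr V) :
    LinSum.eval w C.toSum = natEval w C.terms := by
  obtain ⟨t, d⟩ := C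
  simp only [Constr.toSum]
  induction t with
  | nil => rfl
  | cons p t ih =>
    rw [List.map_cons, LinSum.eval_cons, ih, natEval_cons, Lit.eval_eq_truth]
    split_ifs <;> simp

theorem LinForm.eval_toSum (w : V → Bool) (f : LinForm V) :
    LinSum.eval w f.toSum = termsEval w f.terms := by
  obtain ⟨t, d⟩ := f
  simp only [LinForm.toSum]
  induction t with
  | nil => rfl
  | cons p t ih =>
    rw [List.map_cons, LinSum.eval_cons, ih, termsEval_cons]
    rfl

/-! ## Normalization -/

/-- Rewriting `c x` with `c < 0` as `|c| ¬x - |c|` shifts both sides by the same amount, the sum of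
all such `|c|`. Truncating a negative degree to `0` is harmless because the left-hand side is a
natural number. -/
theorem LinForm.sat_nonneg (w : V → Bool) (f : LinForm V) :
    f.nonneg.Sat w ↔ 0 ≤ f.eval w := by
  obtain ⟨t, k⟩ := f
  simp only [Constr.Sat, LinForm.nonneg, LinForm.eval]
  have key : ((natEval w (t.map fun p =>
      (p.1.natAbs, if 0 < p.1 then Lit.pos p.2 else Lit.neg p.2)) : ℕ) : ℤ) =
      termsEval w t + (t.map fun p => max (-p.1) 0).sum := by
    induction t with
    | nil => rfl
    | cons p t ih =>
      simp only [List.map_cons, natEval_cons, termsEval_cons, List.sum_cons]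
      push_cast
      rw [ih]
      by_cases hp : 0 < p.1
      · have := abs_of_pos hp
        cases h : w p.2 <;> simp [hp, Lit.truth, h] <;> omega
      · have := abs_of_nonpos (not_lt.1 hp)
        cases h : w p.2 <;> simp [hp, Lit.truth, h] <;> omega
  omega

section LinearOrder

variable [LinearOrder V]

/-- Sortedness of `t` plays no role: canonicity matters for syntactic comparison, never for values.
-/
theorem termsEval_insertTerm (w : V → Bool) (c : ℤ) (v : V) (t : List (ℤ × V)) :
    termsEval w (insertTerm c v t) = c * (if w v then 1 else 0) + termsEval w t := by
  induction t with
  | nil =>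
    by_cases hc : c = 0 <;> simp [insertTerm, hc]
  | cons p t ih =>
    obtain ⟨d, u⟩ := p
    unfold insertTerm
    split_ifs with h₁ h₂ h₃ h₄ <;> simp_all <;> grind

theorem LinForm.eval_insertLit (w : V → Bool) (f : LinForm V) (c : ℤ) (l : Lit V) :
    (f.insertLit c l).eval w = c * l.eval w + f.eval w := by
  cases l with
  | pos v =>
    simp only [LinForm.insertLit, LinForm.eval, termsEval_insertTerm, Lit.eval]
    ring
  | neg v =>
    simp only [LinForm.insertLit, LinForm.eval, termsEval_insertTerm, Lit.eval]
    split_ifs <;> ring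

theorem eval_normLin (w : V → Bool) (t : LinSum V) (k : ℤ) :
    (normLin t k).eval w = LinSum.eval w t + k := by
  induction t with
  | nil => simp [normLin, LinForm.eval]
  | cons p t ih =>
    obtain ⟨c, l⟩ := p
    rw [normLin, LinForm.eval_insertLit, ih, LinSum.eval_cons]
    ring

theorem sat_normGe (w : V → Bool) (t : LinSum V) (b : ℤ) :
    (normGe t b).Sat w ↔ b ≤ LinSum.eval w t := by
  rw [normGe, LinForm.sat_nonneg, eval_normLin]
  omega

theorem LinForm.sat_geConstr (w : V → Bool) (f g : LinForm V) :
    (f.geConstr g).Sat w ↔ g.eval w ≤ f.eval w := by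
  rw [LinForm.geConstr, sat_normGe, LinSum.eval_append, LinSum.eval_negate,
    LinForm.eval_toSum, LinForm.eval_toSum, LinForm.eval, LinForm.eval]
  omega

theorem PBConstr.sat_normalize (w : V → Bool) (c : PBConstr V) :
    (∀ C ∈ c.normalize, C.Sat w) ↔ c.rel.holds (c.lhs.eval w) c.rhs := by
  obtain ⟨r, t, b⟩ := c
  cases r <;> simp only [PBConstr.normalize, List.forall_mem_cons, sat_normGe, Rel.holds,
    LinSum.eval_negate, List.not_mem_nil, false_imp_iff, implies_true, and_true] <;> omega

/-- The assignment satisfies all normalized constraints of a list. -/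
def SatAll (w : V → Bool) (L : List (Constr V)) : Prop := ∀ C ∈ L, C.Sat w

theorem satAll_normFormula (w : V → Bool) (fml : List (PBConstr V)) :
    SatAll w (normFormula fml) ↔ Satisfies w {c | c ∈ fml} := by
  simp only [SatAll, normFormula, List.mem_flatMap, Satisfies, Set.mem_ofPred_eq,
    ← PBConstr.sat_normalize]
  exact ⟨fun h c hc C hC => h C ⟨c, hc, hC⟩, fun h C ⟨c, hc, hC⟩ => h c hc C hC⟩

theorem eval_normObj (w : V → Bool) (obj : Option (Objective V)) :
    (normObj obj).eval w = evalObj obj w := by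
  cases obj with
  | none => rfl
  | some o => exact eval_normLin w o.lhs o.const

end LinearOrder

/-! ## Operations on constraints -/

theorem natEval_le_total (w : V → Bool) (C : Constr V) : natEval w C.terms ≤ C.total := by
  obtain ⟨t, d⟩ := C
  simp only [Constr.total]
  induction t with
  | nil => simp
  | cons p t ih =>
    simp only [natEval_cons, List.map_cons, List.sum_cons]
    split_ifs <;> omega

theorem Constr.not_sat_of_contradictory (w : V → Bool) (C : Constr V)
    (h : C.contradictory = true) : ¬C.Sat w := by
  have h₁ := natEval_le_total w C
  have h₂ : C.total < C.degree := by simpa [Constr.contradictory] using h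
  unfold Constr.Sat
  omega

/-- Each coefficient counts in exactly one of the two left-hand sides, so these add up to `C.total`.
The truncated subtraction in the degree only ever makes the negation trivially true. -/
theorem Constr.sat_negate_of_not_sat (w : V → Bool) (C : Constr V) (h : ¬C.Sat w) :
    C.negate.Sat w := by
  have key : natEval w C.negate.terms + natEval w C.terms = C.total := by
    obtain ⟨t, d⟩ := C
    simp only [Constr.total, Constr.negate]
    clear h
    induction t with
    | nil => simp
    | cons p t ih =>
      simp only [natEval_cons, List.map_cons, List.sum_cons, Lit.truth_negate]
      cases p.2.truth w <;> simp <;> omega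
  unfold Constr.Sat at h ⊢
  have : C.negate.degree = C.total + 1 - C.degree := rfl
  omega

theorem Constr.Sat.plus [LinearOrder V] {w : V → Bool} {C D : Constr V} (hC : C.Sat w)
    (hD : D.Sat w) : (C.plus D).Sat w := by
  rw [Constr.plus, sat_normGe, LinSum.eval_append, Constr.eval_toSum, Constr.eval_toSum]
  unfold Constr.Sat at hC hD
  omega

theorem Constr.Sat.times {w : V → Bool} {C : Constr V} (hC : C.Sat w) (k : ℕ) :
    (C.times k).Sat w := by
  have key : natEval w (C.times k).terms = k * natEval w C.terms := by
    obtain ⟨t, d⟩ := C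
    simp only [Constr.times]
    clear hC
    induction t with
    | nil => simp
    | cons p t ih =>
      simp only [natEval_cons, List.map_cons, ih]
      split_ifs <;> ring
  unfold Constr.Sat
  rw [key]
  exact Nat.mul_le_mul_left k hC

theorem le_mul_add_pred_div (a : ℕ) {d : ℕ} (hd : 0 < d) : a ≤ d * ((a + d - 1) / d) := by
  have h₁ := Nat.div_add_mod (a + d - 1) d
  have h₂ := Nat.mod_lt (a + d - 1) hd
  omega

theorem Constr.Sat.divide {w : V → Bool} {C : Constr V} (hC : C.Sat w) {d : ℕ} (hd : 0 < d) :
    (C.divide d).Sat w := by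
  have key : natEval w C.terms ≤ d * natEval w (C.divide d).terms := by
    obtain ⟨t, A⟩ := C
    simp only [Constr.divide]
    clear hC
    induction t with
    | nil => simp
    | cons p t ih =>
      have := le_mul_add_pred_div p.1 hd
      simp only [natEval_cons, List.map_cons, mul_add]
      split_ifs <;> omega
  have hA : C.degree ≤ d * natEval w (C.divide d).terms := le_trans hC key
  -- For an integer `n`, the rounded-up quotient is at most `n` once `A + d - 1 < d * (n + 1)`,
  -- which follows from `A ≤ d * n`.
  refine Nat.le_of_lt_succ (Nat.div_lt_of_lt_mul ?_)
  rw [Nat.mul_succ]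
  omega

theorem Constr.Sat.saturate {w : V → Bool} {C : Constr V} (hC : C.Sat w) :
    C.saturate.Sat w := by
  obtain ⟨t, A⟩ := C
  -- The minimum with `A` makes the claim inductive: either a true literal is capped and already
  -- contributes `A`, or no true coefficient changes. The filter drops only zero terms.
  have key : min (natEval w t) A ≤
      natEval w ((t.map fun p => (min p.1 A, p.2)).filter fun p => p.1 ≠ 0) := by
    clear hC
    induction t with
    | nil => simp
    | cons p t ih =>
      simp only [List.map_cons, List.filter_cons, natEval_cons]
      split_ifs with h₁ h₂ h₂ <;> simp_all <;> omega
  have h : A ≤ natEval w t := hC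
  have : A ≤ natEval w ((t.map fun p => (min p.1 A, p.2)).filter fun p => p.1 ≠ 0) := by
    omega
  exact this

/-! ## Substitutions -/

/-- The assignment `w` composed with a substitution. -/
def Subst.comp [DecidableEq V] (ω : Subst V) (w : V → Bool) (v : V) : Bool :=
  match ω.onLit (.pos v) with
  | .inl b => b
  | .inr l => l.truth w

theorem Subst.truth_comp [DecidableEq V] (ω : Subst V) (w : V → Bool) (l : Lit V) :
    l.truth (ω.comp w) = match ω.onLit l with
      | .inl b => b
      | .inr m => m.truth w := by
  cases l with
  | pos v => rfl
  | neg v =>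
    simp only [Lit.truth, Subst.comp, Subst.onLit]
    rcases h : List.find? (fun p => decide (p.1 = v)) ω with _ | ⟨u, b | l⟩
    · simp [h]
    · simp [h]
    · have := Lit.truth_negate w l
      simp_all [Lit.truth]

section LinearOrder

variable [LinearOrder V]

theorem Subst.eval_onLin (ω : Subst V) (w : V → Bool) (t : LinSum V) (k : ℤ) :
    (ω.onLin t k).eval w = LinSum.eval (ω.comp w) t + k := by
  -- The constant varies because a literal sent to true moves its coefficient there.
  induction t generalizing k with
  | nil => simp [Subst.onLin, LinForm.eval]
  | cons p t ih =>
    obtain ⟨c, l⟩ := p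
    have h := ω.truth_comp w l
    rw [LinSum.eval_cons, Lit.eval_eq_truth, h, Subst.onLin]
    rcases ω.onLit l with (_ | _) | m
    · simp [ih]
    · simp only [ih, if_true]
      ring
    · simp only [LinForm.eval_insertLit, ih, Lit.eval_eq_truth]
      ring

theorem Constr.sat_subst (ω : Subst V) (w : V → Bool) (C : Constr V) :
    (C.subst ω).Sat w ↔ C.Sat (ω.comp w) := by
  rw [Constr.subst, LinForm.sat_nonneg, Subst.eval_onLin, Constr.eval_toSum, Constr.Sat]
  omega

theorem LinForm.eval_subst (ω : Subst V) (w : V → Bool) (f : LinForm V) :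
    (f.subst ω).eval w = f.eval (ω.comp w) := by
  rw [LinForm.subst, Subst.eval_onLin, LinForm.eval_toSum, LinForm.eval]

end LinearOrder

/-! ## Reverse unit propagation -/

section DecidableEq

variable [DecidableEq V]

/-- Terms that evaluate to a positive value come from the literals that `ρ` does not falsify. -/
theorem natEval_le_sum_filter {w : V → Bool} {ρ : List (Lit V)} (hρ : ∀ l ∈ ρ, l.truth w = true)
    (t : List (ℕ × Lit V)) :
    natEval w t ≤ ((t.filter fun p => decide (p.2.negate ∉ ρ)).map fun p => p.1).sum := by
  induction t with
  | nil => simp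
  | cons p t ih =>
    by_cases hp : p.2.negate ∈ ρ
    · have h := hρ _ hp
      rw [Lit.truth_negate] at h
      simp_all
    · rw [List.filter_cons_of_pos (by simpa using hp), List.map_cons, List.sum_cons, natEval_cons]
      split_ifs <;> omega

/-- A literal that `ρ` leaves unfalsified but `w` makes false is counted on the right only, which
leaves a gap of at least its coefficient. This is what justifies propagation. -/
theorem natEval_add_le_sum_filter {w : V → Bool} {ρ : List (Lit V)}
    (hρ : ∀ l ∈ ρ, l.truth w = true) (t : List (ℕ × Lit V)) {p : ℕ × Lit V} (hp : p ∈ t)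
    (hpρ : p.2.negate ∉ ρ) (hpw : p.2.truth w = false) :
    natEval w t + p.1 ≤ ((t.filter fun p => decide (p.2.negate ∉ ρ)).map fun p => p.1).sum := by
  induction t with
  | nil => simp at hp
  | cons q t ih =>
    rcases List.mem_cons.1 hp with rfl | hp
    · have := natEval_le_sum_filter hρ t
      rw [List.filter_cons_of_pos (by simpa using hpρ), List.map_cons, List.sum_cons,
        natEval_cons, hpw]
      simp only [Bool.false_eq_true, if_false]
      omega
    · have ih := ih hp
      by_cases hq : q.2.negate ∈ ρ
      · have h := hρ _ hq
        rw [Lit.truth_negate] at h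
        simp_all
      · rw [List.filter_cons_of_pos (by simpa using hq), List.map_cons, List.sum_cons,
          natEval_cons]
        split_ifs <;> omega

/-- A solution `w` extending `ρ` forces the slack to be nonnegative. Were a propagated literal false
under `w`, the slack would be at least its coefficient, against the propagation condition. -/
theorem propagateConstr_sound {w : V → Bool} {ρ : List (Lit V)} {C : Constr V}
    (hρ : ∀ l ∈ ρ, l.truth w = true) (hC : C.Sat w) :
    ∃ σ, propagateConstr ρ C = some σ ∧ ∀ l ∈ σ, l.truth w = true := by
  have hs := natEval_le_sum_filter hρ C.terms
  unfold Constr.Sat at hC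
  have h0 : ¬slack ρ C < 0 := by
    unfold slack
    omega
  refine ⟨_, by rw [propagateConstr, if_neg h0], ?_⟩
  intro l hl
  rcases List.mem_append.1 hl with hl | hl
  · obtain ⟨p, hp, rfl⟩ := List.mem_map.1 hl
    obtain ⟨hpC, hp⟩ := List.mem_filter.1 hp
    obtain ⟨-, hpρ, hlt⟩ := of_decide_eq_true hp
    by_contra hpw
    have := natEval_add_le_sum_filter hρ C.terms hpC hpρ (by simpa using hpw)
    unfold slack at hlt
    omega
  · exact hρ l hl

theorem foldlM_propagateConstr_sound {w : V → Bool} {db : List (Constr V)}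
    (hdb : ∀ C ∈ db, C.Sat w) {ρ : List (Lit V)} (hρ : ∀ l ∈ ρ, l.truth w = true) :
    ∃ σ, db.foldlM propagateConstr ρ = some σ ∧ ∀ l ∈ σ, l.truth w = true := by
  induction db generalizing ρ with
  | nil => exact ⟨ρ, rfl, hρ⟩
  | cons C db ih =>
    obtain ⟨σ, hσ, hσw⟩ := propagateConstr_sound hρ (hdb C List.mem_cons_self)
    obtain ⟨τ, hτ, hτw⟩ := ih (fun D hD => hdb D (List.mem_cons_of_mem _ hD)) hσw
    exact ⟨τ, by rw [List.foldlM_cons, hσ]; exact hτ, hτw⟩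

/-- A common solution survives every round, so the bound on the number of rounds is irrelevant to
soundness. -/
theorem propagate_eq_false {w : V → Bool} {db : List (Constr V)} (hdb : ∀ C ∈ db, C.Sat w)
    (n : ℕ) {ρ : List (Lit V)} (hρ : ∀ l ∈ ρ, l.truth w = true) : propagate db n ρ = false := by
  induction n generalizing ρ with
  | zero => rfl
  | succ n ih =>
    obtain ⟨σ, hσ, hσw⟩ := foldlM_propagateConstr_sound hdb hρ
    rw [propagate, hσ]
    exact ih hσw

theorem rup_sound {w : V → Bool} {db : List (Constr V)} {C : Constr V} (h : rup db C = true)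
    (hdb : ∀ D ∈ db, D.Sat w) : C.Sat w := by
  by_contra hC
  have hall : ∀ D ∈ C.negate :: db, D.Sat w := by
    intro D hD
    rcases List.mem_cons.1 hD with rfl | hD
    · exact C.sat_negate_of_not_sat w hC
    · exact hdb D hD
  have := propagate_eq_false hall (((C.negate :: db).map fun D => D.terms.length).sum + 1)
    (ρ := []) (by simp)
  simp only [rup] at h
  rw [this] at h
  exact Bool.false_ne_true h

end DecidableEq

/-! ## Derivations -/

/-- The assignment satisfies all constraints of a database. -/
def Database.Sat (w : V → Bool) (db : Database V) : Prop := ∀ e ∈ db, e.2.Sat w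

theorem Database.sat_constrs {w : V → Bool} {db : Database V} :
    (∀ C ∈ db.constrs, C.Sat w) ↔ db.Sat w := by
  simp only [Database.constrs, Database.Sat, List.mem_map]
  exact ⟨fun h e he => h _ ⟨e, he, rfl⟩, fun h C ⟨e, he, hC⟩ => hC ▸ h e he⟩

theorem Database.sat_cons {w : V → Bool} {db : Database V} {e : ℕ × Constr V} :
    Database.Sat w (e :: db) ↔ e.2.Sat w ∧ db.Sat w :=
  List.forall_mem_cons

theorem Database.sat_append {w : V → Bool} {db db' : Database V} :
    Database.Sat w (db ++ db') ↔ db.Sat w ∧ db'.Sat w :=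
  List.forall_mem_append

theorem Database.mem_of_entry {db : Database V} {n : ℕ} {e : ℕ × Constr V}
    (h : db.entry n = some e) : e ∈ db :=
  List.mem_of_find?_eq_some h

theorem Database.Sat.remove {w : V → Bool} {db : Database V} (h : db.Sat w) (n : ℕ) :
    (db.remove n).Sat w :=
  fun e he => h e (List.mem_of_mem_eraseP he)

/-- Numbers need not be distinct here: `entry` and `remove` both pick the first match, so exactly
`e` was lost. -/
theorem Database.sat_of_remove {w : V → Bool} {db : Database V} {n : ℕ} {e : ℕ × Constr V}
    (h : db.entry n = some e) (hdb : (db.remove n).Sat w) (he : e.2.Sat w) : db.Sat w := by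
  induction db with
  | nil => simp [Database.Sat]
  | cons f db ih =>
    by_cases hf : f.1 = n
    · have hef : f = e := by simpa [Database.entry, hf] using h
      have hr : Database.remove (f :: db) n = db := by simp [Database.remove, hf]
      rw [hr] at hdb
      exact Database.sat_cons.2 ⟨hef ▸ he, hdb⟩
    · have h' : Database.entry db n = some e := by simpa [Database.entry, hf] using h
      have hr : Database.remove (f :: db) n = f :: Database.remove db n := by simp [Database.remove, hf]
      rw [hr, Database.sat_cons] at hdb
      exact Database.sat_cons.2 ⟨hdb.1, ih h' hdb.2⟩

section LinearOrder

variable [LinearOrder V]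

theorem CuttingPlanes.run_sound {w : V → Bool} {db : Database V} (hdb : db.Sat w)
    (p : CuttingPlanes V) {C : Constr V} (h : p.run db = some C) : C.Sat w := by
  induction p generalizing C with
  | ref n =>
    obtain ⟨e, he, rfl⟩ := Option.map_eq_some_iff.1 h
    exact hdb e (Database.mem_of_entry he)
  | literalAxiom l =>
    obtain rfl := Option.some.inj h
    exact Nat.zero_le _
  | plus p q ihp ihq =>
    rw [CuttingPlanes.run] at h
    cases hp : p.run db with
    | none => simp [hp] at h
    | some D =>
      cases hq : q.run db with
      | none => simp [hp, hq] at h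
      | some E =>
        obtain rfl : D.plus E = C := by simpa [hp, hq] using h
        exact (ihp hp).plus (ihq hq)
  | times p k ih =>
    rw [CuttingPlanes.run] at h
    split_ifs at h
    obtain ⟨D, hD, rfl⟩ := Option.map_eq_some_iff.1 h
    exact (ih hD).times k
  | divide p d ih =>
    rw [CuttingPlanes.run] at h
    split_ifs at h with hd
    obtain ⟨D, hD, rfl⟩ := Option.map_eq_some_iff.1 h
    exact (ih hD).divide hd
  | saturate p ih =>
    obtain ⟨D, hD, rfl⟩ := Option.map_eq_some_iff.1 h
    exact (ih hD).saturate

theorem ImpStep.run_sound {w : V → Bool} {db : Database V} (hdb : db.Sat w)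
    (s : ImpStep V) {C : Constr V} (h : s.run db = some C) : C.Sat w := by
  cases s with
  | cp p => exact p.run_sound hdb h
  | rup t b =>
    rw [ImpStep.run] at h
    split_ifs at h with hr
    obtain rfl := Option.some.inj h
    exact rup_sound hr (Database.sat_constrs.2 hdb)

theorem runImpSteps_sound {w : V → Bool} (steps : List (ImpStep V)) {db db' : Database V}
    {next : ℕ} (hdb : db.Sat w) (h : runImpSteps db next steps = some db') : db'.Sat w := by
  induction steps generalizing db next with
  | nil =>
    obtain rfl := Option.some.inj h
    exact hdb
  | cons s r ih =>
    rw [runImpSteps] at h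
    cases hs : s.run db with
    | none => simp [hs] at h
    | some C =>
      rw [hs] at h
      exact ih (Database.sat_cons.2 ⟨s.run_sound hdb hs, hdb⟩) h

theorem checkGoal_sound {w : V → Bool} {db : Database V} {next : ℕ} {sub : Option (Subproof V)}
    {G : Constr V} (h : checkGoal db next sub G = true) (hdb : db.Sat w) : G.Sat w := by
  cases sub with
  | none =>
    rcases (Bool.or_eq_true _ _).mp h with h | h
    · exact Database.sat_constrs.2 hdb G (of_decide_eq_true h)
    · exact rup_sound h (Database.sat_constrs.2 hdb)
  | some sp =>
    by_contra hG
    simp only [checkGoal] at h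
    cases hr : runImpSteps ((next, G.negate) :: db) (next + 1) sp.steps with
    | none => simp [hr] at h
    | some db' =>
      cases he : db'.entry sp.contra with
      | none => simp [hr, he] at h
      | some e =>
        have hdb' := runImpSteps_sound (w := w) sp.steps
          (Database.sat_cons.2 ⟨G.sat_negate_of_not_sat w hG, hdb⟩) hr
        simp only [hr, he] at h
        exact e.2.not_sat_of_contradictory w h (hdb' e (Database.mem_of_entry he))

/-- A successful redundance check lets a solution of `db` be changed into one that also satisfies
`C`, without increasing the objective. -/
theorem checkRedundant_sound {w : V → Bool} {db : Database V} {next : ℕ} {O : LinForm V}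
    {C : Constr V} {ω : Subst V} {pfs : Subproofs V}
    (h : checkRedundant db next O C ω pfs = true) (hdb : db.Sat w) :
    ∃ w', db.Sat w' ∧ C.Sat w' ∧ O.eval w' ≤ O.eval w := by
  -- The substitution is applied only when `w` violates `C`; otherwise the hypothesis `¬C` of the
  -- check would not be available.
  by_cases hC : C.Sat w
  · exact ⟨w, hdb, hC, le_rfl⟩
  have hyp : Database.Sat w ((next, C.negate) :: db) :=
    Database.sat_cons.2 ⟨C.sat_negate_of_not_sat w hC, hdb⟩
  simp only [checkRedundant, Bool.and_eq_true, List.all_eq_true] at h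
  obtain ⟨⟨h₁, h₂⟩, h₃⟩ := h
  refine ⟨ω.comp w, fun e he => ?_, ?_, ?_⟩
  · exact (Constr.sat_subst ω w _).1 (checkGoal_sound (h₁ e he) hyp)
  · exact (Constr.sat_subst ω w _).1 (checkGoal_sound h₂ hyp)
  · rw [← LinForm.eval_subst]
    exact (LinForm.sat_geConstr w _ _).1 (checkGoal_sound h₃ hyp)

end LinearOrder

/-! ## The proof checker -/

/-- Every solution of the core can be changed into a solution of all constraints, without
increasing the objective. -/
def State.Valid (s : State V) : Prop :=
  ∀ w, s.core.Sat w → ∃ w', s.all.Sat w' ∧ s.obj.eval w' ≤ s.obj.eval w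

/-- The core of the state has a solution of objective value at most `v`. -/
def State.Attains (s : State V) (v : ℤ) : Prop :=
  ∃ w, s.core.Sat w ∧ s.obj.eval w ≤ v

theorem State.Valid.addDerived {s : State V} {C : Constr V}
    (h : ∀ w, s.all.Sat w → ∃ w', s.all.Sat w' ∧ C.Sat w' ∧ s.obj.eval w' ≤ s.obj.eval w)
    (hs : s.Valid) : (s.addDerived C).Valid := by
  intro w hw
  obtain ⟨w₁, h₁, ho₁⟩ := hs w hw
  obtain ⟨w₂, h₂, hC, ho₂⟩ := h w₁ h₁
  obtain ⟨hc, hd⟩ := Database.sat_append.1 h₂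
  exact ⟨w₂, Database.sat_append.2 ⟨hc, Database.sat_cons.2 ⟨hC, hd⟩⟩, ho₂.trans ho₁⟩

section LinearOrder

variable [LinearOrder V]

/-- The two conclusions go together, since moving a constraint to the core keeps the attained bounds
only thanks to validity. Steps that touch neither core nor objective preserve `Attains`
definitionally. -/
theorem State.step_sound {s s' : State V} {st : Step V} (h : s.step st = some s')
    (hs : s.Valid) : s'.Valid ∧ ∀ v, s.Attains v ↔ s'.Attains v := by
  cases st with
  | derive i =>
    obtain ⟨C, hC, rfl⟩ := Option.map_eq_some_iff.1 h
    exact ⟨hs.addDerived fun w hw => ⟨w, hw, i.run_sound hw hC, le_rfl⟩, fun v => Iff.rfl⟩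
  | red t b ω pfs =>
    simp only [State.step] at h
    split_ifs at h with hr
    obtain rfl := Option.some.inj h
    exact ⟨hs.addDerived fun w hw => checkRedundant_sound hr hw, fun v => Iff.rfl⟩
  | toCore n =>
    simp only [State.step] at h
    cases he : s.derived.entry n with
    | none => simp [he] at h
    | some e =>
      rw [he] at h
      obtain rfl := Option.some.inj h
      have hall : ∀ w, s.all.Sat w → Database.Sat w (e :: s.core) := fun w hw =>
        have hw := Database.sat_append.1 hw
        Database.sat_cons.2 ⟨hw.2 e (Database.mem_of_entry he), hw.1⟩
      refine ⟨fun w hw => ?_, fun v => ⟨fun ⟨w, hw, hv⟩ => ?_, fun ⟨w, hw, hv⟩ => ?_⟩⟩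
      · obtain ⟨w', hw', ho⟩ := hs w (Database.sat_cons.1 hw).2
        exact ⟨w', Database.sat_append.2
          ⟨hall w' hw', (Database.sat_append.1 hw').2.remove n⟩, ho⟩
      -- The given `w` may violate the promoted constraint, so it is replaced by its repair.
      · obtain ⟨w', hw', ho⟩ := hs w hw
        exact ⟨w', hall w' hw', ho.trans hv⟩
      · exact ⟨w, (Database.sat_cons.1 hw).2, hv⟩
  | deleteDerived n =>
    simp only [State.step] at h
    cases he : s.derived.entry n with
    | none => simp [he] at h
    | some e =>
      rw [he] at h
      obtain rfl := Option.some.inj h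
      refine ⟨fun w hw => ?_, fun v => Iff.rfl⟩
      obtain ⟨w', hw', ho⟩ := hs w hw
      have hw' := Database.sat_append.1 hw'
      exact ⟨w', Database.sat_append.2 ⟨hw'.1, hw'.2.remove n⟩, ho⟩
  | deleteCore n ω pfs =>
    simp only [State.step] at h
    cases he : s.core.entry n with
    | none => simp [he] at h
    | some e =>
      rw [he] at h
      simp only at h
      split_ifs at h with hr
      obtain rfl := Option.some.inj h
      -- The deletion check involves core constraints only. The derived set is retained, and its
      -- validity is recovered by a second repair through `hs`.
      have hcore : ∀ w, (s.core.remove n).Sat w →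
          ∃ w', s.core.Sat w' ∧ s.obj.eval w' ≤ s.obj.eval w := fun w hw =>
        have ⟨w', h₁, h₂, ho⟩ := checkRedundant_sound hr hw
        ⟨w', Database.sat_of_remove he h₁ h₂, ho⟩
      refine ⟨fun w hw => ?_, fun v => ⟨fun ⟨w, hw, hv⟩ => ⟨w, hw.remove n, hv⟩,
        fun ⟨w, hw, hv⟩ => ?_⟩⟩
      · obtain ⟨w₁, h₁, ho₁⟩ := hcore w hw
        obtain ⟨w₂, h₂, ho₂⟩ := hs w₁ h₁
        have h₂ := Database.sat_append.1 h₂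
        exact ⟨w₂, Database.sat_append.2 ⟨h₂.1.remove n, h₂.2⟩, ho₂.trans ho₁⟩
      · obtain ⟨w', hw', ho⟩ := hcore w hw
        exact ⟨w', hw', ho.trans hv⟩
  | updateObj o geNew geOld =>
    simp only [State.step] at h
    split_ifs at h with hg
    obtain rfl := Option.some.inj h
    obtain ⟨h₁, h₂⟩ := (Bool.and_eq_true _ _).mp hg
    have heq : ∀ w, s.core.Sat w → (normLin o.lhs o.const).eval w = s.obj.eval w := fun w hw =>
      le_antisymm ((LinForm.sat_geConstr w _ _).1 (checkGoal_sound h₁ hw))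
        ((LinForm.sat_geConstr w _ _).1 (checkGoal_sound h₂ hw))
    refine ⟨fun w hw => ?_, fun v => ⟨fun ⟨w, hw, hv⟩ => ⟨w, hw, (heq w hw).trans_le hv⟩,
      fun ⟨w, hw, hv⟩ => ⟨w, hw, (heq w hw).symm.trans_le hv⟩⟩⟩
    obtain ⟨w', hw', ho⟩ := hs w hw
    refine ⟨w', hw', ?_⟩
    change (normLin o.lhs o.const).eval w' ≤ (normLin o.lhs o.const).eval w
    -- The repaired `w'` still satisfies the core, so the old and new objectives agree there as well
    -- as at `w`.
    rwa [heq w hw, heq w' (Database.sat_append.1 hw').1]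

theorem State.foldlM_step_sound (steps : List (Step V)) {s s' : State V}
    (h : steps.foldlM State.step s = some s') (hs : s.Valid) (v : ℤ) :
    s.Attains v ↔ s'.Attains v := by
  induction steps generalizing s with
  | nil =>
    obtain rfl := Option.some.inj h
    exact Iff.rfl
  | cons st steps ih =>
    rw [List.foldlM_cons] at h
    cases hst : s.step st with
    | none => simp [hst] at h
    | some s₁ =>
      rw [hst] at h
      obtain ⟨hv, ha⟩ := State.step_sound hst hs
      exact (ha v).trans (ih h hv)

theorem constrs_initState (fml : List (PBConstr V)) (obj : Option (Objective V)) :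
    (initState fml obj).core.constrs = normFormula fml := by
  apply List.ext_getElem <;> simp [initState, Database.constrs]

theorem valid_initState (fml : List (PBConstr V)) (obj : Option (Objective V)) :
    (initState fml obj).Valid :=
  fun w hw => ⟨w, Database.sat_append.2 ⟨hw, by simp [initState, Database.Sat]⟩, le_rfl⟩

/-- If the core has the same constraints as a normalized formula and the objectives agree, then
`Attains` has its expected meaning. -/
theorem State.attains_iff {s : State V} {fml : List (PBConstr V)} {obj : Option (Objective V)}
    (hc : ∀ C, C ∈ s.core.constrs ↔ C ∈ normFormula fml) (ho : s.obj = normObj obj) (v : ℤ) :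
    s.Attains v ↔ ∃ w, Satisfies w {c | c ∈ fml} ∧ evalObj obj w ≤ v := by
  simp only [State.Attains, ho, eval_normObj, ← Database.sat_constrs, hc, ← satAll_normFormula,
    SatAll]

end LinearOrder

end CakePB

theorem mainTheorem2 {V : Type*} [LinearOrder V]
    (fml : List (CakePB.PBConstr V)) (obj : Option (CakePB.Objective V))
    (pf : CakePB.PBProof V)
    (fml' : List (CakePB.PBConstr V)) (obj' : Option (CakePB.Objective V))
    (h : CakePB.cakePB fml obj pf fml' obj' = some CakePB.OutputClaim.equioptimal) :
    CakePB.SemOutputEquioptimal {c | c ∈ fml} obj {c | c ∈ fml'} obj' := by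
  intro v
  rw [CakePB.cakePB] at h
  cases hs : pf.steps.foldlM CakePB.State.step (CakePB.initState fml obj) with
  | none => simp [hs] at h
  | some s =>
    cases ho : pf.output with
    | nothing => simp [hs, ho] at h
    | equioptimal =>
      simp only [hs, ho] at h
      split_ifs at h with hc
      simp only [CakePB.checkEquioptimal, Bool.and_eq_true, List.all_eq_true,
        decide_eq_true_eq] at hc
      obtain ⟨⟨h₁, h₂⟩, h₃⟩ := hc
      -- Only membership matters: mutual inclusion suffices, regardless of order, multiplicity or
      -- numbering.
      rw [← CakePB.State.attains_iff (s := CakePB.initState fml obj)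
          (fun C => by rw [CakePB.constrs_initState]) rfl v,
        ← CakePB.State.attains_iff (fun C => ⟨h₁ C, h₂ C⟩) h₃ v]
      exact CakePB.State.foldlM_step_sound pf.steps hs (CakePB.valid_initState fml obj) v
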